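/- Let $d\ge 1$. A measurement with $n$ outcomes on $\mathbb{C}^d$ is a family $E=\{E_a\}_{a=1}^{n}$ of non-zero positive semidefinite operators on $\mathbb{C}^d$ with $\sum_a E_a=\mathbb{1}$. For $p\in[1,\infty]$ and measurements $E=\{E_a\}_{a=1}^{n_E}$, $F=\{F_b\}_{b=1}^{n_F}$ on $\mathbb{C}^d$ put $$\Upsilon_p(E,F):=\sum_{a,b}\big\|[E_a,F_b]\big\|_p ,$$ where $\|\cdot\|_p$ is the Schatten $p$-norm (the vector $p$-norm of the singular values), and let the incompatibility generalized robustness $\eta^g(E,F)$ be the optimal value of the semidefinite program $$\max_{\eta\in\mathbb{R},\,\{G_{ab}\}}\ \eta\quad\text{s.t.}\quad G_{ab}\ge 0,\quad \sum_b G_{ab}\ge\eta E_a\ \ \forall a,\quad \sum_a G_{ab}\ge\eta F_b\ \ \forall b,\quad \sum_{a,b}G_{ab}=\mathbb{1}.$$ Fix $p\in[1,\infty]$, and let $E,F$ be a pair of measurements on $\mathbb{C}^d$ that attains the maximal value of $\Upsilon_p$ in dimension $d$, i.e. $\Upsilon_p(E',F')\le\Upsilon_p(E,F)$ for all pairs of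 measurements $E',F'$ on $\mathbb{C}^d$ with any numbers of outcomes. Then the maximum in the program defining $\eta^g(E,F)$ is attained, $$\eta^g(E,F)=\frac12\left(1+\frac1{\sqrt d}\right),$$ and this is the smallest possible value: $\eta^g(E,F)\le\eta^g(E',F')$ for all pairs of measurements $E',F'$ on $\mathbb{C}^d$ with any numbers of outcomes. -/

import Mathlib

open scoped ENNReal ComplexOrder

/-- A quantum measurement (POVM) with `n` outcomes acting on `ℂ^d`: a family of `n` non-zero
positive semidefinite operators that add up to the identity. -/
structure QMeasurement (d n : ℕ) where
  /-- the measurement operators -/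
  op : Fin n → Matrix (Fin d) (Fin d) ℂ
  posSemidef : ∀ a, (op a).PosSemidef
  ne_zero : ∀ a, op a ≠ 0
  sum_eq_one : ∑ a, op a = 1

/-- The Schatten `p`-norm of an operator on `ℂ^d`, `p ∈ [1, ∞]`: the vector `p`-norm of the vector
of its `d` singular values (with multiplicities). -/
noncomputable def schattenNorm {d : ℕ} (p : ℝ≥0∞) (A : Matrix (Fin d) (Fin d) ℂ) : ℝ :=
  ‖WithLp.toLp p (fun i : Fin d => (Matrix.toEuclideanLin A).singularValues i)‖

/-- The commutation-based incompatibility `Υ_p(E, F) = ∑_{a,b} ‖[E_a, F_b]‖_p`. -/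
noncomputable def commIncompat {d n m : ℕ} (p : ℝ≥0∞)
    (E : QMeasurement d n) (F : QMeasurement d m) : ℝ :=
  ∑ a, ∑ b, schattenNorm p (E.op a * F.op b - F.op b * E.op a)

/-- `(E, F)` attains the maximal value of `Υ_p` among all pairs of measurements on `ℂ^d`,
with arbitrary numbers of outcomes. -/
def IsMaxCommIncompat {d n m : ℕ} (p : ℝ≥0∞)
    (E : QMeasurement d n) (F : QMeasurement d m) : Prop :=
  ∀ (n' m' : ℕ) (E' : QMeasurement d n') (F' : QMeasurement d m'),
    commIncompat p E' F' ≤ commIncompat p E F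

/-- The set of feasible values `η` of the semidefinite program that defines the incompatibility
generalized robustness; `A ≥ B` for operators means that `A - B` is positive semidefinite. -/
def robustnessFeasible {d n m : ℕ} (E : QMeasurement d n) (F : QMeasurement d m) : Set ℝ :=
  {η : ℝ | ∃ G : Fin n → Fin m → Matrix (Fin d) (Fin d) ℂ,
    (∀ a b, (G a b).PosSemidef) ∧
    (∀ a, (∑ b, G a b - (η : ℂ) • E.op a).PosSemidef) ∧
    (∀ b, (∑ a, G a b - (η : ℂ) • F.op b).PosSemidef) ∧
    ∑ a, ∑ b, G a b = 1}

/-- The incompatibility generalized robustness `η^g` of a pair of measurements: the optimal value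
of the semidefinite program. -/
noncomputable def genRobustness {d n m : ℕ} (E : QMeasurement d n) (F : QMeasurement d m) : ℝ :=
  sSup (robustnessFeasible E F)

/-!
The value `½ (1 + 1 / √d)` bounds the generalized robustness of every pair of measurements from
below, and a maximizer of `Υ_p` is rigid enough for a dual certificate to bound it from above by the
same number.

*Primal side.* Write `E_a = ∑_i α_i P_i` with projections `P_i` and `α_i ≥ 0`. The operators
`G_{ab} = c ∑_i α_i (1 + √d P_i) F_b (1 + √d P_i)` form a parent measurement. The constraint
for `E_a` reduces to `P_i ≤ 1`; the one for `F_b` follows by completing a square, as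
`∑ α_i (P_i - 1/d) F_b (P_i - 1/d) ≥ 0`, the sum running over the pieces of all the `E_a`, whose
weights add up to `d` (`half_one_add_inv_sqrt_mem_robustnessFeasible`).

*Maximizers of `Υ_p`.* For `d = 1` the claimed upper bound is the trivial `η ≤ 1`, so let `d ≥ 2`.
Split all operators into rank-one pieces `|v⟩⟨v|` and `|w⟩⟨w|`. Each
commutator of two pieces has two equal singular values `μ`, `μ² = |⟨v,w⟩|² (‖v‖²‖w‖² - |⟨v,w⟩|²)`,
so the triangle inequality (`schattenNorm_sum_commutator_le`) bounds `Υ_p` by `2 ^ (1/p) ∑ μ`.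
The arithmetic–geometric mean inequality `2 √(d-1) μ ≤ (d-2) |⟨v,w⟩|² + ‖v‖²‖w‖²` sums to
`Υ_p ≤ 2 ^ (1/p) d √(d-1)`, which the standard basis and the Fourier basis attain
(`exists_le_commIncompat`). At a maximizer all these inequalities are equalities, so
`‖v‖²‖w‖² = d |⟨v,w⟩|²` for all pieces of all decompositions, hence for all vectors in the ranges of
`E_a` and `F_b` (`norm_sq_mul_norm_sq_eq_of_mul_conjTranspose`). In particular no non-zero vector in
the range of `E_a` is orthogonal to one in the range of `F_b`, which forces all operators to have
rank one.

*Dual side.* For rank-one measurements along unit vectors `e_a`, `f_b` with overlaps `1/√d`, pairing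
the constraints with `|e_a⟩⟨e_a|` and `|f_b⟩⟨f_b|` and using
`|e_a⟩⟨e_a| + |f_b⟩⟨f_b| ≤ 1 + 1/√d` gives `2 d η ≤ (1 + 1/√d) d`
(`le_half_one_add_of_mem_robustnessFeasible`).
-/

/-! ### Rank-one operators -/

/-- The rank-one positive operator `|v⟩⟨v|` of a (not necessarily normalized) vector `v`. -/
noncomputable def ketbra {d : ℕ} (v : EuclideanSpace ℂ (Fin d)) : Matrix (Fin d) (Fin d) ℂ :=
  Matrix.vecMulVec v.ofLp (star v.ofLp)

section ketbra

variable {d : ℕ}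

theorem ketbra_posSemidef (v : EuclideanSpace ℂ (Fin d)) : (ketbra v).PosSemidef :=
  Matrix.posSemidef_vecMulVec_self_star _

theorem dotProduct_star_eq_inner (v w : EuclideanSpace ℂ (Fin d)) :
    star v.ofLp ⬝ᵥ w.ofLp = inner ℂ v w := by
  rw [EuclideanSpace.inner_eq_star_dotProduct, dotProduct_comm]

theorem toEuclideanLin_ketbra_apply (v x : EuclideanSpace ℂ (Fin d)) :
    Matrix.toEuclideanLin (ketbra v) x = inner ℂ v x • v := by
  rw [Matrix.toLpLin_apply, ketbra, Matrix.vecMulVec_mulVec, dotProduct_star_eq_inner]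
  ext i
  simp [mul_comm]

theorem ketbra_smul (c : ℂ) (v : EuclideanSpace ℂ (Fin d)) :
    ketbra (c • v) = ((‖c‖ ^ 2 : ℝ) : ℂ) • ketbra v := by
  push_cast
  rw [← Complex.mul_conj']
  ext i j
  simp only [ketbra, Matrix.vecMulVec_apply, Matrix.smul_apply, WithLp.ofLp_smul, Pi.smul_apply,
    Pi.star_apply, smul_eq_mul, star_mul', starRingEnd_apply]
  ring

theorem trace_ketbra (v : EuclideanSpace ℂ (Fin d)) :
    (ketbra v).trace = ((‖v‖ ^ 2 : ℝ) : ℂ) := by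
  rw [ketbra, Matrix.trace_vecMulVec, dotProduct_comm, dotProduct_star_eq_inner,
    inner_self_eq_norm_sq_to_K]
  simp

theorem ketbra_mul_ketbra (v w : EuclideanSpace ℂ (Fin d)) :
    ketbra v * ketbra w = inner ℂ v w • Matrix.vecMulVec v.ofLp (star w.ofLp) := by
  rw [ketbra, ketbra, Matrix.vecMulVec_mul_vecMulVec, dotProduct_star_eq_inner]
  ext i j
  simp only [Matrix.vecMulVec_apply, Matrix.smul_apply, Pi.smul_apply, smul_eq_mul]
  ring

theorem ketbra_mul_self (v : EuclideanSpace ℂ (Fin d)) :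
    ketbra v * ketbra v = ((‖v‖ ^ 2 : ℝ) : ℂ) • ketbra v := by
  rw [ketbra_mul_ketbra, inner_self_eq_norm_sq_to_K]
  simp [ketbra]

theorem trace_ketbra_mul_ketbra (v w : EuclideanSpace ℂ (Fin d)) :
    (ketbra v * ketbra w).trace = ((‖inner ℂ v w‖ ^ 2 : ℝ) : ℂ) := by
  rw [ketbra_mul_ketbra, Matrix.trace_smul, Matrix.trace_vecMulVec, dotProduct_comm,
    dotProduct_star_eq_inner, ← inner_conj_symm w v, smul_eq_mul, Complex.mul_conj']
  simp

theorem ketbra_mul_mul_ketbra (v w : EuclideanSpace ℂ (Fin d)) :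
    ketbra v * ketbra w * ketbra v = ((‖inner ℂ v w‖ ^ 2 : ℝ) : ℂ) • ketbra v := by
  rw [ketbra_mul_ketbra, smul_mul_assoc, ketbra, Matrix.vecMulVec_mul_vecMulVec,
    dotProduct_star_eq_inner, ← inner_conj_symm w v]
  push_cast
  rw [← Complex.mul_conj', ← smul_smul]
  ext i j
  simp [Matrix.vecMulVec_apply]

theorem ketbra_toEuclideanLin (B : Matrix (Fin d) (Fin d) ℂ) (x : EuclideanSpace ℂ (Fin d)) :
    ketbra (Matrix.toEuclideanLin B x) = B * ketbra x * B.conjTranspose := by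
  rw [ketbra, ketbra, Matrix.mul_vecMulVec, Matrix.vecMulVec_mul, Matrix.toLpLin_apply,
    Matrix.star_mulVec]

theorem sum_ketbra_orthonormalBasis {ι : Type*} [Fintype ι]
    (x : OrthonormalBasis ι ℂ (EuclideanSpace ℂ (Fin d))) : ∑ i, ketbra (x i) = 1 := by
  apply Matrix.toEuclideanLin.injective
  ext1 y
  simp only [map_sum, LinearMap.sum_apply, toEuclideanLin_ketbra_apply]
  rw [x.sum_repr', Matrix.toLpLin_one]
  rfl

/-- A factorization `B Bᴴ` of a positive operator turns every orthonormal basis into a decomposition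
of that operator into rank-one positive operators. -/
theorem sum_ketbra_toEuclideanLin {ι : Type*} [Fintype ι] (B : Matrix (Fin d) (Fin d) ℂ)
    (x : OrthonormalBasis ι ℂ (EuclideanSpace ℂ (Fin d))) :
    ∑ i, ketbra (Matrix.toEuclideanLin B (x i)) = B * B.conjTranspose := by
  simp only [ketbra_toEuclideanLin, ← Finset.sum_mul, ← Finset.mul_sum,
    sum_ketbra_orthonormalBasis, mul_one]

end ketbra

open scoped MatrixOrder in
theorem Matrix.PosSemidef.exists_eq_mul_conjTranspose {d : ℕ} {M : Matrix (Fin d) (Fin d) ℂ}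
    (hM : M.PosSemidef) : ∃ B : Matrix (Fin d) (Fin d) ℂ, M = B * B.conjTranspose := by
  obtain ⟨B, hB⟩ := CStarAlgebra.nonneg_iff_eq_mul_star_self.mp
    (Matrix.nonneg_iff_posSemidef.mpr hM)
  exact ⟨B, hB⟩

theorem Matrix.PosSemidef.trace_mul_nonneg {d : ℕ} {M N : Matrix (Fin d) (Fin d) ℂ}
    (hM : M.PosSemidef) (hN : N.PosSemidef) : 0 ≤ (M * N).trace := by
  obtain ⟨B, rfl⟩ := hN.exists_eq_mul_conjTranspose
  rw [← mul_assoc, Matrix.trace_mul_comm, ← mul_assoc]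
  exact (hM.conjTranspose_mul_mul_same B).trace_nonneg

/-! ### A parent measurement for every pair of measurements -/

theorem Matrix.PosSemidef.exists_sum_ketbra {d : ℕ} {M : Matrix (Fin d) (Fin d) ℂ}
    (hM : M.PosSemidef) : ∃ v : Fin d → EuclideanSpace ℂ (Fin d), M = ∑ i, ketbra (v i) := by
  obtain ⟨B, hB⟩ := hM.exists_eq_mul_conjTranspose
  exact ⟨fun i => Matrix.toEuclideanLin B (EuclideanSpace.basisFun (Fin d) ℂ i),
    by rw [sum_ketbra_toEuclideanLin, hB]⟩

/-- For `v = 0` the projection is `0`, so the zero vectors of a decomposition need no special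
treatment. -/
theorem exists_ketbra_eq_smul_projection {d : ℕ} (v : EuclideanSpace ℂ (Fin d)) :
    ∃ P : Matrix (Fin d) (Fin d) ℂ, P.IsHermitian ∧ P * P = P ∧
      ketbra v = ((‖v‖ ^ 2 : ℝ) : ℂ) • P := by
  by_cases hv : v = 0
  · exact ⟨0, Matrix.isHermitian_zero, by simp, by simp [hv, ketbra]⟩
  · have h : ((‖v‖ ^ 2 : ℝ) : ℂ) ≠ 0 := by
      rw [Complex.ofReal_ne_zero]; exact pow_ne_zero 2 (norm_ne_zero_iff.mpr hv)
    refine ⟨((‖v‖ ^ 2 : ℝ) : ℂ)⁻¹ • ketbra v, ?_, ?_, ?_⟩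
    · rw [Matrix.IsHermitian, Matrix.conjTranspose_smul, (ketbra_posSemidef v).isHermitian.eq,
        ← Complex.ofReal_inv, Complex.star_def, Complex.conj_ofReal]
    · rw [smul_mul_smul_comm, ketbra_mul_self, smul_smul]
      congr 1
      field_simp
    · rw [smul_smul, mul_inv_cancel₀ h, one_smul]

namespace QMeasurement

variable {d n : ℕ}

theorem exists_sum_ketbra (E : QMeasurement d n) :
    ∃ v : Fin n → Fin d → EuclideanSpace ℂ (Fin d), ∀ a, E.op a = ∑ i, ketbra (v a i) := by
  choose v hv using fun a => (E.posSemidef a).exists_sum_ketbra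
  exact ⟨v, hv⟩

theorem sum_norm_sq_eq (E : QMeasurement d n) {v : Fin n → Fin d → EuclideanSpace ℂ (Fin d)}
    (hv : ∀ a, E.op a = ∑ i, ketbra (v a i)) : ∑ a, ∑ i, ‖v a i‖ ^ 2 = d := by
  have h := congrArg Matrix.trace E.sum_eq_one
  simp only [hv, Matrix.trace_sum, trace_ketbra, Matrix.trace_one, Fintype.card_fin] at h
  exact_mod_cast h

end QMeasurement

theorem posSemidef_one_sub_of_isHermitian_of_mul_self {d : ℕ} {P : Matrix (Fin d) (Fin d) ℂ}
    (hP : P.IsHermitian) (hPP : P * P = P) : (1 - P).PosSemidef := by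
  have h : (1 - P).conjTranspose * (1 - P) = 1 - P := by
    rw [Matrix.conjTranspose_sub, Matrix.conjTranspose_one, hP.eq]
    noncomm_ring [hPP]
  rw [← h]
  exact Matrix.posSemidef_conjTranspose_mul_self _

section parent

variable {d : ℕ} {κ : Type*} [Fintype κ]

/-- Completing the square, which turns the constraint on the second marginal of the parent
measurement into a manifestly positive expression. -/
theorem sum_smul_conj_one_add_smul (α : κ → ℂ) (P : κ → Matrix (Fin d) (Fin d) ℂ) {s : ℂ}
    (hs : s ≠ 0) (hα : ∑ k, α k = s ^ 2) (hP : ∑ k, α k • P k = 1)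
    (F : Matrix (Fin d) (Fin d) ℂ) :
    ∑ k, α k • ((1 + s • P k) * F * (1 + s • P k)) - (1 + s) ^ 2 • F =
      s ^ 2 • ∑ k, α k • ((P k - (s ^ 2)⁻¹ • 1) * F * (P k - (s ^ 2)⁻¹ • 1)) := by
  have h1 : ∀ k, α k • ((1 + s • P k) * F * (1 + s • P k)) =
      α k • F + (s • ((α k • P k) * F) + s • (F * (α k • P k))) + s ^ 2 • α k • (P k * F * P k) := by
    intro k
    simp only [add_mul, mul_add, one_mul, mul_one, smul_mul_assoc, mul_smul_comm]
    module
  have h2 : ∀ k, α k • ((P k - (s ^ 2)⁻¹ • 1) * F * (P k - (s ^ 2)⁻¹ • 1)) =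
      α k • (P k * F * P k) - ((s ^ 2)⁻¹ • ((α k • P k) * F) + (s ^ 2)⁻¹ • (F * (α k • P k)))
        + α k • ((s ^ 2)⁻¹ * (s ^ 2)⁻¹) • F := by
    intro k
    simp only [sub_mul, mul_sub, one_mul, mul_one, smul_mul_assoc, mul_smul_comm]
    module
  simp only [h1, h2, Finset.sum_add_distrib, Finset.sum_sub_distrib, ← Finset.smul_sum,
    ← Finset.sum_mul, ← Finset.mul_sum, ← Finset.sum_smul, hα, hP, one_mul, mul_one]
  match_scalars <;> field_simp
  ring

theorem sum_smul_conj_one_add_smul_sub_posSemidef (α : κ → ℝ) (hα0 : ∀ k, 0 ≤ α k)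
    (P : κ → Matrix (Fin d) (Fin d) ℂ) (hPh : ∀ k, (P k).IsHermitian) {s : ℝ}
    (hs : s ≠ 0) (hα : ∑ k, α k = s ^ 2) (hP : ∑ k, (α k : ℂ) • P k = 1)
    {F : Matrix (Fin d) (Fin d) ℂ} (hF : F.PosSemidef) :
    (∑ k, (α k : ℂ) • ((1 + (s : ℂ) • P k) * F * (1 + (s : ℂ) • P k)) -
      (1 + (s : ℂ)) ^ 2 • F).PosSemidef := by
  rw [sum_smul_conj_one_add_smul _ _ (by exact_mod_cast hs) (by exact_mod_cast hα) hP]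
  refine Matrix.PosSemidef.smul (Matrix.posSemidef_sum _ fun k _ => ?_)
    (by exact_mod_cast sq_nonneg s)
  refine Matrix.PosSemidef.smul ?_ (by exact_mod_cast hα0 k)
  have hH : (P k - ((s : ℂ) ^ 2)⁻¹ • 1).conjTranspose = P k - ((s : ℂ) ^ 2)⁻¹ • 1 := by
    rw [Matrix.conjTranspose_sub, (hPh k).eq, Matrix.conjTranspose_smul, Matrix.conjTranspose_one,
      ← Complex.ofReal_pow, ← Complex.ofReal_inv, Complex.star_def, Complex.conj_ofReal]
  have := hF.mul_mul_conjTranspose_same (P k - ((s : ℂ) ^ 2)⁻¹ • 1)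
  rwa [hH] at this

end parent

/-- The parent measurement is `G_{ab} = c ∑_i α_i (1 + s P_i) F_b (1 + s P_i)` with `s = √d`, for a
decomposition `E_a = ∑_i α_i P_i` into projections. Every pair of measurements therefore has
robustness at least `½ (1 + 1/√d)`. -/
theorem half_one_add_inv_sqrt_mem_robustnessFeasible {d n m : ℕ} (hd : 1 ≤ d)
    (E : QMeasurement d n) (F : QMeasurement d m) :
    (1 / 2 : ℝ) * (1 + 1 / Real.sqrt (d : ℝ)) ∈ robustnessFeasible E F := by
  obtain ⟨v, hv⟩ := E.exists_sum_ketbra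
  choose P hPh hPP hvP using fun a i => exists_ketbra_eq_smul_projection (v a i)
  set s : ℝ := Real.sqrt d with hs
  have hs0 : 0 < s := Real.sqrt_pos.mpr (by exact_mod_cast hd)
  have hs2 : s ^ 2 = d := Real.sq_sqrt (Nat.cast_nonneg d)
  -- `c` normalizes the total weight: `∑ G = (d + 2 s + s ^ 2) / (2 s ^ 2 + 2 s) = 1`.
  set c : ℝ := (2 * s ^ 2 + 2 * s)⁻¹ with hc
  have hc0 : 0 ≤ c := by positivity
  have hcη : (1 / 2 : ℝ) * (1 + 1 / s) = c * (1 + s) ^ 2 := by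
    rw [hc]
    field_simp
    ring
  have hcC : ((((1 / 2 : ℝ) * (1 + 1 / s) : ℝ)) : ℂ) = (c : ℂ) * (1 + s) ^ 2 := by
    rw [hcη]; push_cast; rfl
  have hE : ∀ a, E.op a = ∑ i, ((‖v a i‖ ^ 2 : ℝ) : ℂ) • P a i := fun a => by
    simp only [hv, ← hvP]
  have hα : ∑ k : Fin n × Fin d, ‖v k.1 k.2‖ ^ 2 = s ^ 2 := by
    rw [Fintype.sum_prod_type, E.sum_norm_sq_eq hv, hs2]
  have hP1 : ∑ k : Fin n × Fin d, ((‖v k.1 k.2‖ ^ 2 : ℝ) : ℂ) • P k.1 k.2 = 1 := by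
    rw [Fintype.sum_prod_type, ← E.sum_eq_one]
    simp only [hE]
  have hconj : ∀ a i, (1 + (s : ℂ) • P a i).conjTranspose = 1 + (s : ℂ) • P a i := fun a i => by
    rw [Matrix.conjTranspose_add, Matrix.conjTranspose_one, Matrix.conjTranspose_smul,
      (hPh a i).eq, Complex.star_def, Complex.conj_ofReal]
  have hsq : ∀ a i, (1 + (s : ℂ) • P a i) * (1 + (s : ℂ) • P a i) =
      1 + (2 * s + s ^ 2 : ℂ) • P a i := fun a i => by
    simp only [add_mul, mul_add, one_mul, mul_one, smul_mul_assoc, mul_smul_comm, hPP]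
    module
  have hrow : ∀ a, ∑ b, (c : ℂ) • ∑ i, ((‖v a i‖ ^ 2 : ℝ) : ℂ) •
      ((1 + (s : ℂ) • P a i) * F.op b * (1 + (s : ℂ) • P a i)) =
      (c : ℂ) • ∑ i, ((‖v a i‖ ^ 2 : ℝ) : ℂ) • (1 + (2 * s + s ^ 2 : ℂ) • P a i) := fun a => by
    rw [← Finset.smul_sum, Finset.sum_comm]
    simp only [← Finset.smul_sum, ← Finset.sum_mul, ← Finset.mul_sum, F.sum_eq_one, mul_one, hsq]
  refine ⟨fun a b => (c : ℂ) • ∑ i, ((‖v a i‖ ^ 2 : ℝ) : ℂ) •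
    ((1 + (s : ℂ) • P a i) * F.op b * (1 + (s : ℂ) • P a i)), ?_, ?_, ?_, ?_⟩
  · intro a b
    refine Matrix.PosSemidef.smul (Matrix.posSemidef_sum _ fun i _ => ?_) (by exact_mod_cast hc0)
    refine Matrix.PosSemidef.smul ?_ (by exact_mod_cast sq_nonneg ‖v a i‖)
    have := (F.posSemidef b).mul_mul_conjTranspose_same (1 + (s : ℂ) • P a i)
    rwa [hconj] at this
  · intro a
    rw [hrow, hcC, hE, ← smul_smul, ← smul_sub, Finset.smul_sum, ← Finset.sum_sub_distrib]
    refine Matrix.PosSemidef.smul (Matrix.posSemidef_sum _ fun i _ => ?_) (by exact_mod_cast hc0)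
    have h : ((‖v a i‖ ^ 2 : ℝ) : ℂ) • (1 + (2 * s + s ^ 2 : ℂ) • P a i) -
        (1 + (s : ℂ)) ^ 2 • ((‖v a i‖ ^ 2 : ℝ) : ℂ) • P a i =
        ((‖v a i‖ ^ 2 : ℝ) : ℂ) • (1 - P a i) := by module
    rw [h]
    exact (posSemidef_one_sub_of_isHermitian_of_mul_self (hPh a i) (hPP a i)).smul
      (by exact_mod_cast sq_nonneg ‖v a i‖)
  · intro b
    rw [hcC, ← smul_smul, ← Finset.smul_sum, ← smul_sub, ← Fintype.sum_prod_type']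
    exact (sum_smul_conj_one_add_smul_sub_posSemidef (κ := Fin n × Fin d)
      (fun k => ‖v k.1 k.2‖ ^ 2) (fun k => sq_nonneg _) (fun k => P k.1 k.2)
      (fun k => hPh _ _) hs0.ne' hα hP1 (F.posSemidef b)).smul (by exact_mod_cast hc0)
  · simp only [hrow]
    rw [← Finset.smul_sum, ← Fintype.sum_prod_type']
    have h : ∀ k : Fin n × Fin d, ((‖v k.1 k.2‖ ^ 2 : ℝ) : ℂ) •
        (1 + (2 * s + s ^ 2 : ℂ) • P k.1 k.2) = ((‖v k.1 k.2‖ ^ 2 : ℝ) : ℂ) • 1 +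
        (2 * s + s ^ 2 : ℂ) • ((‖v k.1 k.2‖ ^ 2 : ℝ) : ℂ) • P k.1 k.2 := fun k => by module
    simp only [h, Finset.sum_add_distrib, ← Finset.smul_sum, hP1, ← Finset.sum_smul]
    rw [← Complex.ofReal_sum, hα, ← add_smul, smul_smul]
    have : (c : ℂ) * (((s ^ 2 : ℝ) : ℂ) + (2 * s + s ^ 2)) = ((c * (s ^ 2 + (2 * s + s ^ 2)) : ℝ) : ℂ) := by
      push_cast; ring
    rw [this, hc]
    have h1 : (2 * s ^ 2 + 2 * s)⁻¹ * (s ^ 2 + (2 * s + s ^ 2)) = 1 := by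
      field_simp
      ring
    rw [h1, Complex.ofReal_one, one_smul]

/-! ### The dual bound for rank-one measurements -/

theorem le_one_of_mem_robustnessFeasible {d n m : ℕ} (hd : 1 ≤ d) {E : QMeasurement d n}
    {F : QMeasurement d m} {η : ℝ} (hη : η ∈ robustnessFeasible E F) : η ≤ 1 := by
  obtain ⟨G, -, hE, -, h1⟩ := hη
  have h := (Matrix.posSemidef_sum Finset.univ fun a _ => hE a).trace_nonneg
  rw [Finset.sum_sub_distrib, h1, ← Finset.smul_sum, E.sum_eq_one, Matrix.trace_sub,
    Matrix.trace_smul, Matrix.trace_one, Fintype.card_fin, smul_eq_mul, sub_nonneg] at h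
  have h' : η * d ≤ d := by exact_mod_cast h
  have hd' : (0 : ℝ) < d := by exact_mod_cast hd
  nlinarith

/-- The largest eigenvalue of `|e⟩⟨e| + |f⟩⟨f|` is at most `1 + |⟨e, f⟩|`. For orthogonal vectors this
is Bessel's inequality. -/
theorem norm_inner_sq_add_norm_inner_sq_le {V : Type*} [NormedAddCommGroup V]
    [InnerProductSpace ℂ V] {e f : V} (he : ‖e‖ ≤ 1) (hf : ‖f‖ ≤ 1) (x : V) :
    ‖inner ℂ e x‖ ^ 2 + ‖inner ℂ f x‖ ^ 2 ≤ (1 + ‖inner ℂ e f‖) * ‖x‖ ^ 2 := by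
  set p := inner ℂ e x with hp
  set q := inner ℂ f x with hq
  set c := inner ℂ e f with hc
  set S := ‖p‖ ^ 2 + ‖q‖ ^ 2 with hS
  -- `S` is the inner product of `x` with `y`, which is itself controlled by `S`.
  set y := p • e + q • f with hy
  have hxy : inner ℂ y x = (S : ℂ) := by
    rw [hy, inner_add_left, inner_smul_left, inner_smul_left, ← hp, ← hq, Complex.conj_mul',
      Complex.conj_mul', hS]
    push_cast; rfl
  have hyy : ‖y‖ ^ 2 ≤ (1 + ‖c‖) * S := by
    rw [hy, @norm_add_sq ℂ, norm_smul, norm_smul, inner_smul_left, inner_smul_right, ← hc]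
    have h1 : RCLike.re ((starRingEnd ℂ) p * (q * c)) ≤ ‖p‖ * (‖q‖ * ‖c‖) := by
      refine (RCLike.re_le_norm _).trans ?_
      rw [norm_mul, norm_mul, RCLike.norm_conj]
    have h2 : (‖p‖ * ‖e‖) ^ 2 ≤ ‖p‖ ^ 2 := by
      gcongr
      exact mul_le_of_le_one_right (norm_nonneg p) he
    have h3 : (‖q‖ * ‖f‖) ^ 2 ≤ ‖q‖ ^ 2 := by
      gcongr
      exact mul_le_of_le_one_right (norm_nonneg q) hf
    nlinarith [mul_nonneg (norm_nonneg c) (sq_nonneg (‖p‖ - ‖q‖))]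
  have h2 : S ≤ ‖y‖ * ‖x‖ := by
    have := norm_inner_le_norm (𝕜 := ℂ) y x
    rw [hxy, Complex.norm_real] at this
    exact (le_abs_self S).trans this
  have hS0 : 0 ≤ S := by positivity
  rcases hS0.eq_or_lt with h0 | h0
  · rw [← h0]; positivity
  · have h3 : S * S ≤ S * ((1 + ‖c‖) * ‖x‖ ^ 2) := by
      calc S * S ≤ (‖y‖ * ‖x‖) * (‖y‖ * ‖x‖) := mul_self_le_mul_self hS0 h2
        _ = ‖y‖ ^ 2 * ‖x‖ ^ 2 := by ring
        _ ≤ ((1 + ‖c‖) * S) * ‖x‖ ^ 2 := by gcongr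
        _ = S * ((1 + ‖c‖) * ‖x‖ ^ 2) := by ring
    exact le_of_mul_le_mul_left h3 h0

theorem inner_toEuclideanLin_ketbra_self {d : ℕ} (e x : EuclideanSpace ℂ (Fin d)) :
    inner ℂ x (Matrix.toEuclideanLin (ketbra e) x) = ((‖inner ℂ e x‖ ^ 2 : ℝ) : ℂ) := by
  rw [toEuclideanLin_ketbra_apply, inner_smul_right, ← inner_conj_symm x e, Complex.mul_conj']
  push_cast; rfl

theorem smul_one_sub_ketbra_sub_ketbra_posSemidef {d : ℕ} {e f : EuclideanSpace ℂ (Fin d)}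
    (he : ‖e‖ = 1) (hf : ‖f‖ = 1) {c : ℝ} (hc : ‖inner ℂ e f‖ ≤ c) :
    (((1 + c : ℝ) : ℂ) • 1 - (ketbra e + ketbra f)).PosSemidef := by
  rw [← Matrix.isPositive_toEuclideanLin_iff, LinearMap.isPositive_iff]
  constructor
  · rw [Matrix.isSymmetric_toEuclideanLin_iff]
    refine Matrix.IsHermitian.sub ?_
      ((ketbra_posSemidef e).isHermitian.add (ketbra_posSemidef f).isHermitian)
    rw [Matrix.IsHermitian, Matrix.conjTranspose_smul, Matrix.conjTranspose_one, Complex.star_def,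
      Complex.conj_ofReal]
  · intro x
    have h : inner ℂ x (Matrix.toEuclideanLin (((1 + c : ℝ) : ℂ) • 1 - (ketbra e + ketbra f)) x) =
        (((1 + c) * ‖x‖ ^ 2 - (‖inner ℂ e x‖ ^ 2 + ‖inner ℂ f x‖ ^ 2) : ℝ) : ℂ) := by
      rw [map_sub, map_add, map_smul, LinearMap.sub_apply, LinearMap.add_apply, inner_sub_right,
        inner_add_right, inner_toEuclideanLin_ketbra_self, inner_toEuclideanLin_ketbra_self,
        LinearMap.smul_apply, inner_smul_right, Matrix.toLpLin_one, LinearMap.id_apply,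
        inner_self_eq_norm_sq_to_K]
      push_cast; rfl
    have h' := norm_inner_sq_add_norm_inner_sq_le he.le hf.le x
    have h0 : 0 ≤ (1 + c) * ‖x‖ ^ 2 - (‖inner ℂ e x‖ ^ 2 + ‖inner ℂ f x‖ ^ 2) := by
      nlinarith [sq_nonneg ‖x‖]
    rw [← inner_conj_symm, h, Complex.conj_ofReal]
    exact_mod_cast h0

/-- Weak duality: for rank-one measurements whose directions have overlap at most `c`, the
projections onto these directions are a dual feasible point of value `(1 + c) / 2`. -/
theorem le_half_one_add_of_mem_robustnessFeasible {d n m : ℕ} (hd : 1 ≤ d) {E : QMeasurement d n}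
    {F : QMeasurement d m} {α : Fin n → ℝ} {e : Fin n → EuclideanSpace ℂ (Fin d)}
    {β : Fin m → ℝ} {f : Fin m → EuclideanSpace ℂ (Fin d)} (he : ∀ a, ‖e a‖ = 1)
    (hf : ∀ b, ‖f b‖ = 1) (hE : ∀ a, E.op a = (α a : ℂ) • ketbra (e a))
    (hF : ∀ b, F.op b = (β b : ℂ) • ketbra (f b)) {c : ℝ} (hc : ∀ a b, ‖inner ℂ (e a) (f b)‖ ≤ c)
    {η : ℝ} (hη : η ∈ robustnessFeasible E F) : η ≤ (1 / 2 : ℝ) * (1 + c) := by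
  obtain ⟨G, hG, hGE, hGF, h1⟩ := hη
  have hα : ∑ a, (α a : ℂ) = d := by
    have h := congrArg Matrix.trace E.sum_eq_one
    simpa [hE, Matrix.trace_sum, trace_ketbra, he] using h
  have hβ : ∑ b, (β b : ℂ) = d := by
    have h := congrArg Matrix.trace F.sum_eq_one
    simpa [hF, Matrix.trace_sum, trace_ketbra, hf] using h
  have hA : (0 : ℂ) ≤ ∑ a, ∑ b, (G a b * (((1 + c : ℝ) : ℂ) • 1 -
      (ketbra (e a) + ketbra (f b)))).trace :=
    Finset.sum_nonneg fun a _ => Finset.sum_nonneg fun b _ => (hG a b).trace_mul_nonneg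
      (smul_one_sub_ketbra_sub_ketbra_posSemidef (he a) (hf b) (hc a b))
  have hB : (0 : ℂ) ≤ ∑ a, ((∑ b, G a b - (η : ℂ) • E.op a) * ketbra (e a)).trace :=
    Finset.sum_nonneg fun a _ => (hGE a).trace_mul_nonneg (ketbra_posSemidef _)
  have hC : (0 : ℂ) ≤ ∑ b, ((∑ a, G a b - (η : ℂ) • F.op b) * ketbra (f b)).trace :=
    Finset.sum_nonneg fun b _ => (hGF b).trace_mul_nonneg (ketbra_posSemidef _)
  have hT : ∑ a, ∑ b, (G a b).trace = d := by
    have h := congrArg Matrix.trace h1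
    simpa [Matrix.trace_sum] using h
  simp only [mul_sub, mul_add, Matrix.trace_sub, Matrix.trace_add, mul_smul_comm, mul_one,
    Matrix.trace_smul, smul_eq_mul, Finset.sum_sub_distrib, Finset.sum_add_distrib,
    ← Finset.mul_sum, hT] at hA
  simp only [hE, sub_mul, Finset.sum_mul, smul_mul_assoc, ketbra_mul_self, he, Matrix.trace_sub,
    Matrix.trace_sum, Matrix.trace_smul, trace_ketbra, one_pow, Complex.ofReal_one, smul_eq_mul,
    mul_one, Finset.sum_sub_distrib, ← Finset.mul_sum, hα] at hB
  simp only [hF, sub_mul, Finset.sum_mul, smul_mul_assoc, ketbra_mul_self, hf, Matrix.trace_sub,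
    Matrix.trace_sum, Matrix.trace_smul, trace_ketbra, one_pow, Complex.ofReal_one, smul_eq_mul,
    mul_one, Finset.sum_sub_distrib, ← Finset.mul_sum, hβ] at hC
  rw [Finset.sum_comm] at hC
  have h := add_nonneg (add_nonneg hA hB) hC
  have h2 : (0 : ℂ) ≤ (((1 + c) * d - η * d - η * d : ℝ) : ℂ) := by
    convert h using 1
    push_cast
    ring
  have h3 : 0 ≤ (1 + c) * d - η * d - η * d := by exact_mod_cast h2
  have hd' : (0 : ℝ) < d := by exact_mod_cast hd
  nlinarith

/-! ### Singular values of sums of commutators -/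

section singularValueDecomposition

variable {V : Type*} [NormedAddCommGroup V] [InnerProductSpace ℂ V] [FiniteDimensional ℂ V]

theorem exists_singular_value_decomposition {d : ℕ} (hd : Module.finrank ℂ V = d) (T : V →ₗ[ℂ] V) :
    ∃ x y : OrthonormalBasis (Fin d) ℂ V, ∀ k, T (x k) = (T.singularValues k : ℂ) • y k := by
  set x := T.isSymmetric_adjoint_comp_self.eigenvectorBasis hd with hx
  have hTT : ∀ i j, inner ℂ (T (x i)) (T (x j)) =
      if i = j then ((T.singularValues j : ℂ)) ^ 2 else 0 := by
    intro i j
    have h := T.isSymmetric_adjoint_comp_self.apply_eigenvectorBasis hd j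
    rw [← hx, ← T.sq_singularValues_fin hd j, LinearMap.comp_apply] at h
    rw [← LinearMap.adjoint_inner_right, h, inner_smul_right,
      orthonormal_iff_ite.mp x.orthonormal i j]
    split_ifs <;> simp
  set s : Set (Fin d) := {k | T.singularValues k ≠ 0} with hs
  have hv : Orthonormal ℂ
      (s.domRestrict fun k => ((T.singularValues k : ℂ))⁻¹ • T (x k)) := by
    rw [orthonormal_iff_ite]
    rintro ⟨i, hi⟩ ⟨j, hj⟩
    simp only [Set.domRestrict_apply, inner_smul_left, inner_smul_right, hTT, Subtype.mk.injEq]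
    split_ifs with hij
    · subst hij
      have : (T.singularValues i : ℂ) ≠ 0 := by exact_mod_cast hi
      rw [← Complex.ofReal_inv, Complex.conj_ofReal]
      push_cast
      field_simp
    · simp
  obtain ⟨y, hy⟩ := hv.exists_orthonormalBasis_extension_of_card_eq (by simp [hd])
  refine ⟨x, y, fun k => ?_⟩
  by_cases hk : T.singularValues k = 0
  · have h := hTT k k
    rw [if_pos rfl, hk, Complex.ofReal_zero, zero_pow two_ne_zero, inner_self_eq_zero] at h
    rw [h, hk, Complex.ofReal_zero, zero_smul]
  · rw [hy k hk, smul_smul, mul_inv_cancel₀ (by exact_mod_cast hk), one_smul]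

end singularValueDecomposition

/-- The common value of the two possibly non-zero singular values of `[|v⟩⟨v|, |w⟩⟨w|]`. -/
noncomputable def commWeight {V : Type*} [NormedAddCommGroup V] [InnerProductSpace ℂ V]
    (v w : V) : ℝ :=
  Real.sqrt (‖inner ℂ v w‖ ^ 2 * (‖v‖ ^ 2 * ‖w‖ ^ 2 - ‖inner ℂ v w‖ ^ 2))

section commutator

variable {V : Type*} [NormedAddCommGroup V] [InnerProductSpace ℂ V]

theorem commWeight_nonneg (v w : V) : 0 ≤ commWeight v w := Real.sqrt_nonneg _

/-- On the plane spanned by `v` and `w`, with its orthonormal basis `a, b` from the Gram–Schmidt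
process, the commutator `[|v⟩⟨v|, |w⟩⟨w|]` is an off-diagonal matrix with both entries of modulus
`commWeight v w`. If `v` and `w` are linearly dependent, some of `a, b` are `0`. -/
theorem exists_norm_commutator_form_le (v w : V) : ∃ a b : V, ‖a‖ ≤ 1 ∧ ‖b‖ ≤ 1 ∧
    inner ℂ a b = 0 ∧ ∀ x y : V,
      ‖inner ℂ v w * inner ℂ w x * inner ℂ y v - inner ℂ w v * inner ℂ v x * inner ℂ y w‖ ≤
        commWeight v w * (‖inner ℂ b x‖ * ‖inner ℂ y a‖ + ‖inner ℂ a x‖ * ‖inner ℂ y b‖) := by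
  by_cases hv : v = 0
  · exact ⟨0, 0, by simp, by simp, by simp, fun x y => by simp [hv]⟩
  have hr : ‖v‖ ≠ 0 := norm_ne_zero_iff.mpr hv
  have hrC : (‖v‖ : ℂ) ≠ 0 := by exact_mod_cast hr
  set a : V := (‖v‖ : ℂ)⁻¹ • v with ha
  have hva : v = (‖v‖ : ℂ) • a := by rw [ha, smul_smul, mul_inv_cancel₀ hrC, one_smul]
  have ha1 : ‖a‖ = 1 := by
    rw [ha, norm_smul, norm_inv, Complex.norm_real, norm_norm, inv_mul_cancel₀ hr]
  have haa : inner ℂ a a = 1 := by rw [inner_self_eq_norm_sq_to_K, ha1]; simp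
  set c := inner ℂ a w with hc
  set u : V := w - c • a with hu
  set b : V := (‖u‖ : ℂ)⁻¹ • u with hb
  have hau : inner ℂ a u = 0 := by rw [hu, inner_sub_right, inner_smul_right, haa, ← hc]; simp
  have hub : u = (‖u‖ : ℂ) • b := by
    by_cases h : u = 0
    · simp [h]
    · rw [hb, smul_smul, mul_inv_cancel₀ (by exact_mod_cast norm_ne_zero_iff.mpr h), one_smul]
  have hb1 : ‖b‖ ≤ 1 := by
    rw [hb, norm_smul, norm_inv, Complex.norm_real, norm_norm]
    exact inv_mul_le_one
  have hw : w = c • a + (‖u‖ : ℂ) • b := by rw [← hub, hu]; abel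
  have hvw : inner ℂ v w = ‖v‖ * c := by
    rw [hva, inner_smul_left, Complex.conj_ofReal, ← hc, ← hva]
  have hu2 : ‖u‖ ^ 2 = ‖w‖ ^ 2 - ‖c‖ ^ 2 := by
    have h : w = c • a + u := by rw [hu]; abel
    have h' : ‖w‖ ^ 2 = ‖c‖ ^ 2 + ‖u‖ ^ 2 := by
      rw [h, @norm_add_sq ℂ, inner_smul_left, hau, norm_smul, ha1]
      simp
    linarith
  have hm : commWeight v w = ‖v‖ ^ 2 * (‖c‖ * ‖u‖) := by
    rw [commWeight, hvw, norm_mul, Complex.norm_real, norm_norm]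
    have h : (‖v‖ * ‖c‖) ^ 2 * (‖v‖ ^ 2 * ‖w‖ ^ 2 - (‖v‖ * ‖c‖) ^ 2) =
        (‖v‖ ^ 2 * (‖c‖ * ‖u‖)) ^ 2 := by
      linear_combination -(‖v‖ ^ 4 * ‖c‖ ^ 2) * hu2
    rw [h, Real.sqrt_sq (by positivity)]
  refine ⟨a, b, ha1.le, hb1, by rw [hb, inner_smul_right, hau, mul_zero], fun x y => ?_⟩
  have hwx : inner ℂ w x = starRingEnd ℂ c * inner ℂ a x + ‖u‖ * inner ℂ b x := by
    conv_lhs => rw [hw]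
    rw [inner_add_left, inner_smul_left a x c, inner_smul_left b x, Complex.conj_ofReal]
  have hyw : inner ℂ y w = c * inner ℂ y a + ‖u‖ * inner ℂ y b := by
    conv_lhs => rw [hw]
    rw [inner_add_right, inner_smul_right y a c, inner_smul_right y b]
  have hvx : inner ℂ v x = ‖v‖ * inner ℂ a x := by
    conv_lhs => rw [hva]
    rw [inner_smul_left, Complex.conj_ofReal]
  have hyv : inner ℂ y v = ‖v‖ * inner ℂ y a := by
    conv_lhs => rw [hva]
    rw [inner_smul_right]
  have hwv : inner ℂ w v = ‖v‖ * starRingEnd ℂ c := by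
    rw [← inner_conj_symm, hvw, map_mul, Complex.conj_ofReal]
  have key : inner ℂ v w * inner ℂ w x * inner ℂ y v - inner ℂ w v * inner ℂ v x * inner ℂ y w =
      (‖v‖ ^ 2 * ‖u‖ : ℂ) * (c * (inner ℂ b x * inner ℂ y a) -
        starRingEnd ℂ c * (inner ℂ a x * inner ℂ y b)) := by
    rw [hvw, hwv, hwx, hyw, hvx, hyv]
    ring
  rw [key, hm, norm_mul, norm_mul, norm_pow, Complex.norm_real, Complex.norm_real, norm_norm,
    norm_norm]
  calc _ ≤ ‖v‖ ^ 2 * ‖u‖ * (‖c * (inner ℂ b x * inner ℂ y a)‖ +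
        ‖starRingEnd ℂ c * (inner ℂ a x * inner ℂ y b)‖) := by
        gcongr
        exact norm_sub_le _ _
    _ = _ := by
        simp only [norm_mul, RCLike.norm_conj]
        ring

/-- In any pair of orthonormal bases, the diagonal of `[|v⟩⟨v|, |w⟩⟨w|]` obeys the operator norm bound
and the trace norm bound of an operator with two singular values `commWeight v w`. -/
theorem commutator_form_bounds {ι : Type*} [Fintype ι] (v w : V)
    (x y : OrthonormalBasis ι ℂ V) :
    (∀ k, ‖inner ℂ v w * inner ℂ w (x k) * inner ℂ (y k) v -
        inner ℂ w v * inner ℂ v (x k) * inner ℂ (y k) w‖ ≤ commWeight v w) ∧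
      ∑ k, ‖inner ℂ v w * inner ℂ w (x k) * inner ℂ (y k) v -
        inner ℂ w v * inner ℂ v (x k) * inner ℂ (y k) w‖ ≤ 2 * commWeight v w := by
  obtain ⟨a, b, ha, hb, hab, h⟩ := exists_norm_commutator_form_le v w
  have hm := commWeight_nonneg v w
  constructor
  · intro k
    refine (h _ _).trans (mul_le_of_le_one_right hm ?_)
    have h1 := norm_inner_sq_add_norm_inner_sq_le ha hb (x k)
    have h2 := norm_inner_sq_add_norm_inner_sq_le ha hb (y k)
    rw [hab, x.norm_eq_one] at h1
    rw [hab, y.norm_eq_one, norm_inner_symm, norm_inner_symm b] at h2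
    simp only [norm_zero] at h1 h2
    nlinarith [sq_nonneg (‖inner ℂ b (x k)‖ - ‖inner ℂ (y k) a‖),
      sq_nonneg (‖inner ℂ a (x k)‖ - ‖inner ℂ (y k) b‖)]
  · refine (Finset.sum_le_sum fun k _ => h (x k) (y k)).trans ?_
    rw [← Finset.mul_sum, mul_comm]
    refine mul_le_mul_of_nonneg_right ?_ hm
    have h1 : ∀ k, ‖inner ℂ b (x k)‖ * ‖inner ℂ (y k) a‖ + ‖inner ℂ a (x k)‖ * ‖inner ℂ (y k) b‖ ≤
        (1 / 2) * (‖inner ℂ b (x k)‖ ^ 2 + ‖inner ℂ (y k) a‖ ^ 2 + ‖inner ℂ a (x k)‖ ^ 2 +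
          ‖inner ℂ (y k) b‖ ^ 2) := fun k => by
      nlinarith [sq_nonneg (‖inner ℂ b (x k)‖ - ‖inner ℂ (y k) a‖),
        sq_nonneg (‖inner ℂ a (x k)‖ - ‖inner ℂ (y k) b‖)]
    refine (Finset.sum_le_sum fun k _ => h1 k).trans ?_
    rw [← Finset.mul_sum]
    simp only [Finset.sum_add_distrib, x.sum_sq_norm_inner_left, y.sum_sq_norm_inner_right]
    have ha2 : ‖a‖ ^ 2 ≤ 1 := pow_le_one₀ (norm_nonneg a) ha
    have hb2 : ‖b‖ ^ 2 ≤ 1 := pow_le_one₀ (norm_nonneg b) hb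
    linarith

end commutator

/-- Interpolation between the `∞`-norm and the `1`-norm. For `p = ∞` the exponent `1 / p.toReal` is
`1 / 0 = 0`, which is the correct value of `1 / p`. -/
theorem norm_toLp_le_of_abs_le {ι : Type*} [Fintype ι] {p : ℝ≥0∞} (hp : 1 ≤ p) {D : ι → ℝ} {μ : ℝ}
    (hμ : 0 ≤ μ) (h1 : ∀ k, |D k| ≤ μ) (h2 : ∑ k, |D k| ≤ 2 * μ) :
    ‖WithLp.toLp p D‖ ≤ 2 ^ (1 / p.toReal) * μ := by
  rcases eq_or_ne p ∞ with rfl | htop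
  · rw [PiLp.norm_eq_ciSup]
    simpa using Real.iSup_le h1 hμ
  · have hr : 1 ≤ p.toReal := by
      rw [← ENNReal.toReal_one]; exact ENNReal.toReal_mono htop hp
    set r := p.toReal with hrdef
    have hr0 : 0 < r := by linarith
    rw [PiLp.norm_eq_sum (by rwa [← hrdef]), ← hrdef]
    have h3 : ∑ k, ‖D k‖ ^ r ≤ 2 * μ ^ r := by
      calc ∑ k, ‖D k‖ ^ r ≤ ∑ k, |D k| * μ ^ (r - 1) := by
            refine Finset.sum_le_sum fun k _ => ?_
            rw [Real.norm_eq_abs]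
            rcases (abs_nonneg (D k)).eq_or_lt with h0 | h0
            · rw [← h0, Real.zero_rpow hr0.ne', zero_mul]
            · calc |D k| ^ r = |D k| * |D k| ^ (r - 1) := by
                    rw [← Real.rpow_one_add' h0.le (by linarith)]; congr 1; ring
                _ ≤ _ := mul_le_mul_of_nonneg_left
                    (Real.rpow_le_rpow h0.le (h1 k) (by linarith)) h0.le
        _ = (∑ k, |D k|) * μ ^ (r - 1) := by rw [Finset.sum_mul]
        _ ≤ 2 * μ * μ ^ (r - 1) := by gcongr
        _ = 2 * μ ^ r := by
            rw [mul_assoc, ← Real.rpow_one_add' hμ (by linarith)]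
            congr 2; ring
    calc (∑ k, ‖D k‖ ^ r) ^ (1 / r) ≤ (2 * μ ^ r) ^ (1 / r) := by gcongr
      _ = 2 ^ (1 / r) * μ := by
        rw [Real.mul_rpow (by norm_num) (by positivity), one_div, Real.rpow_rpow_inv hμ hr0.ne']

/-- The triangle inequality for the Schatten norm, for sums of commutators of rank-one operators:
read off on the singular vectors of the sum, each summand has a diagonal whose `p`-norm is at most
its Schatten norm. -/
theorem schattenNorm_sum_commutator_le {d : ℕ} {p : ℝ≥0∞} (hp : 1 ≤ p) {κ : Type*} [Fintype κ]
    (v w : κ → EuclideanSpace ℂ (Fin d)) :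
    schattenNorm p (∑ l, (ketbra (v l) * ketbra (w l) - ketbra (w l) * ketbra (v l))) ≤
      2 ^ (1 / p.toReal) * ∑ l, commWeight (v l) (w l) := by
  have : Fact (1 ≤ p) := ⟨hp⟩
  set T := Matrix.toEuclideanLin
    (∑ l, (ketbra (v l) * ketbra (w l) - ketbra (w l) * ketbra (v l))) with hT
  obtain ⟨x, y, hxy⟩ := exists_singular_value_decomposition (d := d) (by simp) T
  set K : κ → Fin d → ℂ := fun l k => inner ℂ (v l) (w l) * inner ℂ (w l) (x k) *
    inner ℂ (y k) (v l) - inner ℂ (w l) (v l) * inner ℂ (v l) (x k) * inner ℂ (y k) (w l) with hK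
  have hσ : ∀ k : Fin d, (T.singularValues k : ℂ) = ∑ l, K l k := by
    intro k
    have h : inner ℂ (y k) (T (x k)) = (T.singularValues k : ℂ) := by
      rw [hxy, inner_smul_right, inner_self_eq_norm_sq_to_K, y.norm_eq_one]; simp
    rw [← h, hT]
    simp only [map_sum, map_sub, Matrix.toLpLin_mul_same, LinearMap.sum_apply, LinearMap.sub_apply,
      LinearMap.comp_apply, toEuclideanLin_ketbra_apply, inner_sum, inner_sub_right,
      inner_smul_right, hK]
    refine Finset.sum_congr rfl fun l _ => ?_
    ring
  have hσ' : WithLp.toLp p (fun k : Fin d => T.singularValues k) =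
      ∑ l, WithLp.toLp p (fun k => (K l k).re) := by
    ext k
    have := congrArg Complex.re (hσ k)
    rw [Complex.ofReal_re, Complex.re_sum] at this
    simpa using this
  rw [schattenNorm, ← hT, hσ', Finset.mul_sum]
  refine (norm_sum_le _ _).trans (Finset.sum_le_sum fun l _ => ?_)
  obtain ⟨h1, h2⟩ := commutator_form_bounds (v l) (w l) x y
  exact norm_toLp_le_of_abs_le hp (commWeight_nonneg _ _)
    (fun k => (Complex.abs_re_le_norm _).trans (h1 k))
    ((Finset.sum_le_sum fun k _ => Complex.abs_re_le_norm _).trans h2)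

/-! ### Rigidity of the maximizers -/

theorem commWeight_sq {V : Type*} [NormedAddCommGroup V] [InnerProductSpace ℂ V] (v w : V) :
    commWeight v w ^ 2 = ‖inner ℂ v w‖ ^ 2 * (‖v‖ ^ 2 * ‖w‖ ^ 2 - ‖inner ℂ v w‖ ^ 2) := by
  refine Real.sq_sqrt (mul_nonneg (sq_nonneg _) (sub_nonneg.mpr ?_))
  rw [← mul_pow]
  exact pow_le_pow_left₀ (norm_nonneg _) (norm_inner_le_norm v w) 2

theorem two_mul_sqrt_mul_commWeight_le {V : Type*} [NormedAddCommGroup V] [InnerProductSpace ℂ V]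
    {r : ℝ} (hr : 1 ≤ r) (v w : V) :
    2 * Real.sqrt (r - 1) * commWeight v w ≤
      (r - 2) * ‖inner ℂ v w‖ ^ 2 + ‖v‖ ^ 2 * ‖w‖ ^ 2 := by
  have h1 : Real.sqrt (r - 1) ^ 2 = r - 1 := Real.sq_sqrt (by linarith)
  have h2 := commWeight_sq v w
  have hN : ‖inner ℂ v w‖ ^ 2 ≤ ‖v‖ ^ 2 * ‖w‖ ^ 2 := by
    rw [← mul_pow]
    exact pow_le_pow_left₀ (norm_nonneg _) (norm_inner_le_norm v w) 2
  refine abs_le_of_sq_le_sq' ?_ ?_ |>.2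
  · rw [mul_pow, mul_pow, h1, h2]
    nlinarith [sq_nonneg (r * ‖inner ℂ v w‖ ^ 2 - ‖v‖ ^ 2 * ‖w‖ ^ 2)]
  · nlinarith [sq_nonneg ‖inner ℂ v w‖]

/-- The equality case of the arithmetic–geometric mean inequality
`two_mul_sqrt_mul_commWeight_le`. -/
theorem norm_sq_mul_norm_sq_eq_of_two_mul_sqrt_mul_commWeight_eq {V : Type*}
    [NormedAddCommGroup V] [InnerProductSpace ℂ V] {r : ℝ} (hr : 1 ≤ r) {v w : V}
    (h : 2 * Real.sqrt (r - 1) * commWeight v w =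
      (r - 2) * ‖inner ℂ v w‖ ^ 2 + ‖v‖ ^ 2 * ‖w‖ ^ 2) :
    ‖v‖ ^ 2 * ‖w‖ ^ 2 = r * ‖inner ℂ v w‖ ^ 2 := by
  have h1 : Real.sqrt (r - 1) ^ 2 = r - 1 := Real.sq_sqrt (by linarith)
  have h2 := commWeight_sq v w
  have h3 := congrArg (· ^ 2) h
  simp only [mul_pow, h1, h2] at h3
  have h4 : (r * ‖inner ℂ v w‖ ^ 2 - ‖v‖ ^ 2 * ‖w‖ ^ 2) ^ 2 = 0 := by linear_combination -h3
  have := pow_eq_zero_iff two_ne_zero |>.mp h4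
  linarith

section decomposition

variable {d n m : ℕ} {E : QMeasurement d n} {F : QMeasurement d m}
  {v : Fin n → Fin d → EuclideanSpace ℂ (Fin d)} {w : Fin m → Fin d → EuclideanSpace ℂ (Fin d)}

theorem commIncompat_le_sum_commWeight {p : ℝ≥0∞} (hp : 1 ≤ p)
    (hv : ∀ a, E.op a = ∑ i, ketbra (v a i)) (hw : ∀ b, F.op b = ∑ j, ketbra (w b j)) :
    commIncompat p E F ≤ 2 ^ (1 / p.toReal) *
      ∑ k : (Fin n × Fin m) × Fin d × Fin d, commWeight (v k.1.1 k.2.1) (w k.1.2 k.2.2) := by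
  rw [commIncompat, ← Fintype.sum_prod_type', Fintype.sum_prod_type (α₁ := Fin n × Fin m),
    Finset.mul_sum]
  refine Finset.sum_le_sum fun k _ => ?_
  have h : E.op k.1 * F.op k.2 - F.op k.2 * E.op k.1 = ∑ l : Fin d × Fin d,
      (ketbra (v k.1 l.1) * ketbra (w k.2 l.2) - ketbra (w k.2 l.2) * ketbra (v k.1 l.1)) := by
    rw [Finset.sum_sub_distrib, Fintype.sum_prod_type, Fintype.sum_prod_type_right, hv, hw,
      Finset.sum_mul_sum, Finset.sum_mul_sum]
  rw [h]
  exact schattenNorm_sum_commutator_le hp _ _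

theorem sum_norm_inner_sq_eq
    (hv : ∀ a, E.op a = ∑ i, ketbra (v a i)) (hw : ∀ b, F.op b = ∑ j, ketbra (w b j)) :
    ∑ k : (Fin n × Fin m) × Fin d × Fin d, ‖inner ℂ (v k.1.1 k.2.1) (w k.1.2 k.2.2)‖ ^ 2 = d := by
  have h : ((∑ a, E.op a) * ∑ b, F.op b).trace = d := by
    rw [E.sum_eq_one, F.sum_eq_one, mul_one, Matrix.trace_one, Fintype.card_fin]
  rw [Finset.sum_mul_sum] at h
  simp only [hv, hw, Finset.sum_mul_sum, Matrix.trace_sum, trace_ketbra_mul_ketbra] at h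
  simp only [Fintype.sum_prod_type]
  exact_mod_cast h

theorem sum_norm_sq_mul_norm_sq_eq
    (hv : ∀ a, E.op a = ∑ i, ketbra (v a i)) (hw : ∀ b, F.op b = ∑ j, ketbra (w b j)) :
    ∑ k : (Fin n × Fin m) × Fin d × Fin d, ‖v k.1.1 k.2.1‖ ^ 2 * ‖w k.1.2 k.2.2‖ ^ 2 =
      (d : ℝ) ^ 2 := by
  have h : (∑ a, ∑ i, ‖v a i‖ ^ 2) * ∑ b, ∑ j, ‖w b j‖ ^ 2 = (d : ℝ) ^ 2 := by
    rw [E.sum_norm_sq_eq hv, F.sum_norm_sq_eq hw, sq]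
  rw [Finset.sum_mul_sum] at h
  simp only [Finset.sum_mul_sum] at h
  simpa only [Fintype.sum_prod_type] using h

/-- If `Υ_p` reaches the value it takes on a pair of mutually unbiased bases, then the vectors of
all rank-one decompositions of the two measurements are unbiased. -/
theorem norm_sq_mul_norm_sq_eq_of_le_commIncompat {p : ℝ≥0∞} (hp : 1 ≤ p) (hd : 2 ≤ d)
    (hv : ∀ a, E.op a = ∑ i, ketbra (v a i)) (hw : ∀ b, F.op b = ∑ j, ketbra (w b j))
    (h : 2 ^ (1 / p.toReal) * (d * Real.sqrt (d - 1)) ≤ commIncompat p E F)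
    (a : Fin n) (i : Fin d) (b : Fin m) (j : Fin d) :
    ‖v a i‖ ^ 2 * ‖w b j‖ ^ 2 = d * ‖inner ℂ (v a i) (w b j)‖ ^ 2 := by
  have hd1 : (2 : ℝ) ≤ d := by exact_mod_cast hd
  have hd2 : (1 : ℝ) ≤ d := by linarith
  have hs : Real.sqrt ((d : ℝ) - 1) ^ 2 = d - 1 := Real.sq_sqrt (by linarith)
  have h1 := le_of_mul_le_mul_left (h.trans (commIncompat_le_sum_commWeight hp hv hw))
    (by positivity)
  have h2 : ∀ k ∈ (Finset.univ : Finset ((Fin n × Fin m) × Fin d × Fin d)),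
      2 * Real.sqrt ((d : ℝ) - 1) * commWeight (v k.1.1 k.2.1) (w k.1.2 k.2.2) ≤
      ((d : ℝ) - 2) * ‖inner ℂ (v k.1.1 k.2.1) (w k.1.2 k.2.2)‖ ^ 2 +
        ‖v k.1.1 k.2.1‖ ^ 2 * ‖w k.1.2 k.2.2‖ ^ 2 :=
    fun k _ => two_mul_sqrt_mul_commWeight_le hd2 _ _
  have h3 : ∑ k : (Fin n × Fin m) × Fin d × Fin d,
      (((d : ℝ) - 2) * ‖inner ℂ (v k.1.1 k.2.1) (w k.1.2 k.2.2)‖ ^ 2 +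
        ‖v k.1.1 k.2.1‖ ^ 2 * ‖w k.1.2 k.2.2‖ ^ 2) = (2 * d * (d - 1) : ℝ) := by
    rw [Finset.sum_add_distrib, ← Finset.mul_sum, sum_norm_inner_sq_eq hv hw,
      sum_norm_sq_mul_norm_sq_eq hv hw]
    ring
  have h4 : 2 * (d : ℝ) * (d - 1) ≤ ∑ k : (Fin n × Fin m) × Fin d × Fin d,
      2 * Real.sqrt ((d : ℝ) - 1) * commWeight (v k.1.1 k.2.1) (w k.1.2 k.2.2) := by
    rw [← Finset.mul_sum]
    calc 2 * (d : ℝ) * (d - 1) = 2 * Real.sqrt ((d : ℝ) - 1) * (d * Real.sqrt (d - 1)) := by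
          linear_combination (-2 * (d : ℝ)) * hs
      _ ≤ _ := mul_le_mul_of_nonneg_left h1 (by positivity)
  have h5 := (Finset.sum_eq_sum_iff_of_le h2).mp
    (le_antisymm (Finset.sum_le_sum h2) (h3.le.trans h4)) ((a, b), i, j) (Finset.mem_univ _)
  exact norm_sq_mul_norm_sq_eq_of_two_mul_sqrt_mul_commWeight_eq hd2 h5

end decomposition

theorem exists_orthonormalBasis_apply_eq {d : ℕ} {x : EuclideanSpace ℂ (Fin d)} (hx : ‖x‖ = 1) :
    ∃ (e : OrthonormalBasis (Fin d) ℂ (EuclideanSpace ℂ (Fin d))) (i : Fin d), e i = x := by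
  have hd : d ≠ 0 := by
    rintro rfl
    rw [Subsingleton.elim x 0, norm_zero] at hx
    exact zero_ne_one hx
  have : NeZero d := ⟨hd⟩
  have hv : Orthonormal ℂ (({0} : Set (Fin d)).domRestrict fun _ => x) := by
    rw [orthonormal_iff_ite]
    rintro ⟨i, hi⟩ ⟨j, hj⟩
    rw [Set.mem_singleton_iff] at hi hj
    subst hi hj
    simp [inner_self_eq_norm_sq_to_K, hx]
  obtain ⟨e, he⟩ := hv.exists_orthonormalBasis_extension_of_card_eq (by simp)
  exact ⟨e, 0, he 0 rfl⟩

/-- At a maximizer all vectors in the ranges of the measurement operators are unbiased: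
factorizations `B Bᴴ` turn every orthonormal basis into a rank-one decomposition, and each unit
vector belongs to an orthonormal basis. -/
theorem norm_sq_mul_norm_sq_eq_of_mul_conjTranspose {d n m : ℕ} {E : QMeasurement d n}
    {F : QMeasurement d m} {p : ℝ≥0∞} (hp : 1 ≤ p) (hd : 2 ≤ d)
    {B : Fin n → Matrix (Fin d) (Fin d) ℂ} {C : Fin m → Matrix (Fin d) (Fin d) ℂ}
    (hB : ∀ a, E.op a = B a * (B a).conjTranspose) (hC : ∀ b, F.op b = C b * (C b).conjTranspose)
    (h : 2 ^ (1 / p.toReal) * (d * Real.sqrt (d - 1)) ≤ commIncompat p E F)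
    (a : Fin n) (b : Fin m) (x y : EuclideanSpace ℂ (Fin d)) :
    ‖Matrix.toEuclideanLin (B a) x‖ ^ 2 * ‖Matrix.toEuclideanLin (C b) y‖ ^ 2 =
      d * ‖inner ℂ (Matrix.toEuclideanLin (B a) x) (Matrix.toEuclideanLin (C b) y)‖ ^ 2 := by
  by_cases hx : x = 0
  · simp [hx]
  by_cases hy : y = 0
  · simp [hy]
  have hx0 : ‖x‖ ≠ 0 := norm_ne_zero_iff.mpr hx
  have hy0 : ‖y‖ ≠ 0 := norm_ne_zero_iff.mpr hy
  obtain ⟨e, i, hei⟩ := exists_orthonormalBasis_apply_eq (x := (‖x‖ : ℂ)⁻¹ • x)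
    (by rw [norm_smul, norm_inv, Complex.norm_real, norm_norm, inv_mul_cancel₀ hx0])
  obtain ⟨f, j, hfj⟩ := exists_orthonormalBasis_apply_eq (x := (‖y‖ : ℂ)⁻¹ • y)
    (by rw [norm_smul, norm_inv, Complex.norm_real, norm_norm, inv_mul_cancel₀ hy0])
  have key := norm_sq_mul_norm_sq_eq_of_le_commIncompat hp hd
    (v := fun a i => Matrix.toEuclideanLin (B a) (e i))
    (w := fun b j => Matrix.toEuclideanLin (C b) (f j))
    (fun a => by rw [hB, sum_ketbra_toEuclideanLin])
    (fun b => by rw [hC, sum_ketbra_toEuclideanLin]) h a i b j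
  simp only [hei, hfj, map_smul, norm_smul, inner_smul_left, inner_smul_right, norm_mul, norm_inv,
    RCLike.norm_conj, Complex.norm_real, norm_norm] at key
  field_simp at key
  linarith

/-- A positive operator `B Bᴴ` has rank at most one as soon as some linear functional
is injective on the range of `B`. -/
theorem exists_eq_smul_ketbra_of_inner_injective {d : ℕ} {B : Matrix (Fin d) (Fin d) ℂ}
    {f : EuclideanSpace ℂ (Fin d)} (hM : B * B.conjTranspose ≠ 0)
    (hf : ∀ x, inner ℂ (Matrix.toEuclideanLin B x) f = 0 → Matrix.toEuclideanLin B x = 0) :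
    ∃ (α : ℝ) (x : EuclideanSpace ℂ (Fin d)), ‖Matrix.toEuclideanLin B x‖ = 1 ∧
      B * B.conjTranspose = (α : ℂ) • ketbra (Matrix.toEuclideanLin B x) := by
  have hB : Matrix.toEuclideanLin B ≠ 0 := by
    rintro h
    rw [LinearEquiv.map_eq_zero_iff] at h
    exact hM (by rw [h, zero_mul])
  obtain ⟨x₁, hx₁⟩ : ∃ x, Matrix.toEuclideanLin B x ≠ 0 := by
    by_contra! h
    exact hB (LinearMap.ext h)
  obtain ⟨x, hx⟩ : ∃ x, ‖Matrix.toEuclideanLin B x‖ = 1 := by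
    have h0 : ‖Matrix.toEuclideanLin B x₁‖ ≠ 0 := norm_ne_zero_iff.mpr hx₁
    refine ⟨(‖Matrix.toEuclideanLin B x₁‖ : ℂ)⁻¹ • x₁, ?_⟩
    rw [map_smul, norm_smul, norm_inv, Complex.norm_real, norm_norm, inv_mul_cancel₀ h0]
  have hx0 : inner ℂ f (Matrix.toEuclideanLin B x) ≠ 0 := fun h => by
    rw [hf x (inner_eq_zero_symm.mp h), norm_zero] at hx
    exact zero_ne_one hx
  have hprop : ∀ y, ∃ c : ℂ, Matrix.toEuclideanLin B y = c • Matrix.toEuclideanLin B x := by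
    intro y
    refine ⟨inner ℂ f (Matrix.toEuclideanLin B y) / inner ℂ f (Matrix.toEuclideanLin B x), ?_⟩
    rw [← sub_eq_zero, ← map_smul, ← map_sub]
    -- The functional `⟨f, ·⟩` vanishes on `B y - c • B x` by the choice of `c`.
    apply hf
    rw [inner_eq_zero_symm, map_sub, map_smul, inner_sub_right, inner_smul_right,
      div_mul_cancel₀ _ hx0, sub_self]
  choose c hc using hprop
  refine ⟨∑ i, ‖c (EuclideanSpace.basisFun (Fin d) ℂ i)‖ ^ 2, x, hx, ?_⟩
  rw [← sum_ketbra_toEuclideanLin B (EuclideanSpace.basisFun (Fin d) ℂ), Complex.ofReal_sum,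
    Finset.sum_smul]
  refine Finset.sum_congr rfl fun i _ => ?_
  rw [hc, ketbra_smul]

/-- Measurements reaching the value of `Υ_p` on mutually unbiased bases consist of rank-one
operators, so the dual bound applies with overlap `1 / √d`. -/
theorem le_of_mem_robustnessFeasible_of_le_commIncompat {d n m : ℕ} {E : QMeasurement d n}
    {F : QMeasurement d m} {p : ℝ≥0∞} (hp : 1 ≤ p) (hd : 2 ≤ d)
    (h : 2 ^ (1 / p.toReal) * (d * Real.sqrt (d - 1)) ≤ commIncompat p E F)
    {η : ℝ} (hη : η ∈ robustnessFeasible E F) :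
    η ≤ (1 / 2 : ℝ) * (1 + 1 / Real.sqrt d) := by
  choose B hB using fun a => (E.posSemidef a).exists_eq_mul_conjTranspose
  choose C hC using fun b => (F.posSemidef b).exists_eq_mul_conjTranspose
  have key := norm_sq_mul_norm_sq_eq_of_mul_conjTranspose hp hd hB hC h
  have hd0 : (d : ℝ) ≠ 0 := by
    have : d ≠ 0 := by omega
    exact_mod_cast this
  have hne : ∀ {M : Matrix (Fin d) (Fin d) ℂ}, M * M.conjTranspose ≠ 0 →
      ∃ x, Matrix.toEuclideanLin M x ≠ 0 := by
    intro M hM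
    by_contra! h0
    have : M = 0 := by
      rw [← LinearEquiv.map_eq_zero_iff Matrix.toEuclideanLin]
      exact LinearMap.ext h0
    exact hM (by rw [this, zero_mul])
  have : NeZero d := ⟨by omega⟩
  have hn : Nonempty (Fin n) := by
    by_contra hn
    rw [not_nonempty_iff] at hn
    have := E.sum_eq_one
    simp at this
  have hm : Nonempty (Fin m) := by
    by_contra hm
    rw [not_nonempty_iff] at hm
    have := F.sum_eq_one
    simp at this
  obtain ⟨a₀⟩ := hn
  obtain ⟨b₀⟩ := hm
  obtain ⟨x₀, hx₀⟩ := hne (by rw [← hB]; exact E.ne_zero a₀)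
  obtain ⟨y₀, hy₀⟩ := hne (by rw [← hC]; exact F.ne_zero b₀)
  choose α x hx hE using fun a => exists_eq_smul_ketbra_of_inner_injective (B := B a)
    (f := Matrix.toEuclideanLin (C b₀) y₀) (by rw [← hB]; exact E.ne_zero a) fun x hx => by
      have := key a b₀ x y₀
      rw [hx, norm_zero, zero_pow two_ne_zero, mul_zero, mul_eq_zero] at this
      simpa [hy₀] using this
  choose β y hy hF using fun b => exists_eq_smul_ketbra_of_inner_injective (B := C b)
    (f := Matrix.toEuclideanLin (B a₀) x₀) (by rw [← hC]; exact F.ne_zero b) fun y hy => by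
      have := key a₀ b x₀ y
      rw [inner_eq_zero_symm.mp hy, norm_zero, zero_pow two_ne_zero, mul_zero, mul_eq_zero] at this
      simpa [hx₀] using this
  refine le_half_one_add_of_mem_robustnessFeasible (by omega) hx hy
    (fun a => (hB a).trans (hE a)) (fun b => (hC b).trans (hF b)) (fun a b => ?_) hη
  have h1 := key a b (x a) (y b)
  rw [hx, hy] at h1
  rw [one_div, ← Real.sqrt_inv]
  refine Real.le_sqrt_of_sq_le (le_of_eq ?_)
  field_simp
  linarith

/-! ### Mutually unbiased bases attain the bound -/

theorem trace_mul_ketbra {d : ℕ} (M : Matrix (Fin d) (Fin d) ℂ) (x : EuclideanSpace ℂ (Fin d)) :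
    (M * ketbra x).trace = inner ℂ x (Matrix.toEuclideanLin M x) := by
  rw [ketbra, Matrix.mul_vecMulVec, Matrix.trace_vecMulVec, dotProduct_comm,
    ← dotProduct_star_eq_inner, Matrix.toLpLin_apply]

/-- The singular values of a matrix `A` with `(AᴴA)² = μ² AᴴA` are `0` and `μ`, and the trace of
`AᴴA` counts how often `μ` occurs. -/
theorem le_schattenNorm_of_sq_eq_smul {d : ℕ} {p : ℝ≥0∞} (hp : 1 ≤ p)
    {A : Matrix (Fin d) (Fin d) ℂ} {μ : ℝ} (hμ : 0 < μ)
    (hA : A.conjTranspose * A * (A.conjTranspose * A) = ((μ ^ 2 : ℝ) : ℂ) • (A.conjTranspose * A))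
    (htr : (A.conjTranspose * A).trace = ((2 * μ ^ 2 : ℝ) : ℂ)) :
    2 ^ (1 / p.toReal) * μ ≤ schattenNorm p A := by
  have : Fact (1 ≤ p) := ⟨hp⟩
  have hd : Module.finrank ℂ (EuclideanSpace ℂ (Fin d)) = d := by simp
  set T := Matrix.toEuclideanLin A with hT
  set M := A.conjTranspose * A with hM
  set x := T.isSymmetric_adjoint_comp_self.eigenvectorBasis hd with hx
  have hMx : ∀ k : Fin d, Matrix.toEuclideanLin M (x k) =
      ((T.singularValues k ^ 2 : ℝ) : ℂ) • x k := by
    intro k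
    have h := T.isSymmetric_adjoint_comp_self.apply_eigenvectorBasis hd k
    rw [← hx, ← T.sq_singularValues_fin hd k, hT, ← Matrix.toEuclideanLin_conjTranspose_eq_adjoint,
      ← Matrix.toLpLin_mul_same] at h
    exact h
  have hσ : ∀ k : Fin d, T.singularValues k = 0 ∨ T.singularValues k = μ := by
    intro k
    have h := congrArg (fun N => Matrix.toEuclideanLin N (x k)) hA
    simp only [Matrix.toLpLin_mul_same, LinearMap.comp_apply, map_smul, LinearMap.smul_apply, hMx,
      smul_smul] at h
    have h' := smul_left_injective ℂ (x.orthonormal.ne_zero k) h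
    have h2 : T.singularValues k ^ 2 * T.singularValues k ^ 2 = μ ^ 2 * T.singularValues k ^ 2 := by
      exact_mod_cast h'
    rcases eq_or_ne (T.singularValues k) 0 with h0 | h0
    · exact Or.inl h0
    · have h3 := mul_right_cancel₀ (pow_ne_zero 2 h0) h2
      exact Or.inr ((pow_left_inj₀ (T.singularValues_nonneg k) hμ.le two_ne_zero).mp h3)
  have hsum : ∑ k : Fin d, T.singularValues k ^ 2 = 2 * μ ^ 2 := by
    have h : M.trace = ∑ k, (M * ketbra (x k)).trace := by
      rw [← Matrix.trace_sum, ← Finset.mul_sum, sum_ketbra_orthonormalBasis, mul_one]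
    simp only [trace_mul_ketbra, hMx, inner_smul_right, inner_self_eq_norm_sq_to_K, x.norm_eq_one,
      htr] at h
    have h' : ((2 * μ ^ 2 : ℝ) : ℂ) = ((∑ k : Fin d, T.singularValues k ^ 2 : ℝ) : ℂ) := by
      rw [h, Complex.ofReal_sum]
      simp
    exact_mod_cast h'.symm
  rw [schattenNorm, ← hT]
  rcases eq_or_ne p ∞ with rfl | htop
  · obtain ⟨k, -, hk⟩ : ∃ k ∈ (Finset.univ : Finset (Fin d)), T.singularValues k ^ 2 ≠ 0 := by
      apply Finset.exists_ne_zero_of_sum_ne_zero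
      rw [hsum]; positivity
    have hk' : T.singularValues k = μ := (hσ k).resolve_left fun h => hk (by rw [h]; norm_num)
    have h := PiLp.norm_apply_le (WithLp.toLp ∞ fun k : Fin d => T.singularValues k) k
    simp only [hk', Real.norm_eq_abs, abs_of_pos hμ] at h
    simpa using h
  · have hr : 0 < p.toReal := ENNReal.toReal_pos (by rintro rfl; simp at hp) htop
    set r := p.toReal with hrdef
    rw [PiLp.norm_eq_sum (by rwa [← hrdef]), ← hrdef]
    have h : ∑ k : Fin d, ‖T.singularValues k‖ ^ r = 2 * μ ^ r := by
      calc ∑ k : Fin d, ‖T.singularValues k‖ ^ r =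
            ∑ k : Fin d, T.singularValues k ^ 2 * μ ^ (r - 2) := by
            refine Finset.sum_congr rfl fun k _ => ?_
            rcases hσ k with h0 | h0
            · rw [h0, norm_zero, Real.zero_rpow hr.ne', zero_pow two_ne_zero, zero_mul]
            · rw [h0, Real.norm_of_nonneg hμ.le, ← Real.rpow_natCast, ← Real.rpow_add hμ]
              congr 1; push_cast; ring
        _ = 2 * (μ ^ 2 * μ ^ (r - 2)) := by rw [← Finset.sum_mul, hsum, mul_assoc]
        _ = 2 * μ ^ r := by
            rw [← Real.rpow_natCast, ← Real.rpow_add hμ]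
            congr 2; push_cast; ring
    simp only [h]
    rw [Real.mul_rpow (by norm_num) (by positivity), one_div, Real.rpow_rpow_inv hμ.le hr.ne']

/-- With `S = (P - Q)²` for the two projections, `AᴴA = t S` and `S² = (1 - t) S`, where
`t = |⟨e, f⟩|²` and `A = P Q - Q P`. -/
theorem le_schattenNorm_commutator_ketbra {d : ℕ} {p : ℝ≥0∞} (hp : 1 ≤ p)
    {e f : EuclideanSpace ℂ (Fin d)} (he : ‖e‖ = 1) (hf : ‖f‖ = 1) {μ : ℝ} (hμ : 0 < μ)
    (hef : ‖inner ℂ e f‖ ^ 2 * (1 - ‖inner ℂ e f‖ ^ 2) = μ ^ 2) :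
    2 ^ (1 / p.toReal) * μ ≤ schattenNorm p (ketbra e * ketbra f - ketbra f * ketbra e) := by
  set P := ketbra e with hP
  set Q := ketbra f with hQ
  set t : ℂ := ((‖inner ℂ e f‖ ^ 2 : ℝ) : ℂ) with ht
  have hPP : P * P = P := by rw [hP, ketbra_mul_self, he]; simp
  have hQQ : Q * Q = Q := by rw [hQ, ketbra_mul_self, hf]; simp
  have hPQP : P * Q * P = t • P := ketbra_mul_mul_ketbra e f
  have hQPQ : Q * P * Q = t • Q := by rw [hP, hQ, ketbra_mul_mul_ketbra, norm_inner_symm]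
  have hPt : P.trace = 1 := by rw [hP, trace_ketbra, he]; simp
  have hQt : Q.trace = 1 := by rw [hQ, trace_ketbra, hf]; simp
  have hPQt : (P * Q).trace = t := trace_ketbra_mul_ketbra e f
  have hμt : ((μ ^ 2 : ℝ) : ℂ) = t * (1 - t) := by rw [← hef, ht]; push_cast; ring
  set S := P + Q - P * Q - Q * P with hS
  have hM : (P * Q - Q * P).conjTranspose * (P * Q - Q * P) = t • S := by
    rw [Matrix.conjTranspose_sub, Matrix.conjTranspose_mul, Matrix.conjTranspose_mul,
      (ketbra_posSemidef e).isHermitian.eq, (ketbra_posSemidef f).isHermitian.eq, ← hP, ← hQ]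
    calc (Q * P - P * Q) * (P * Q - Q * P) =
          Q * (P * P) * Q - Q * P * Q * P - P * Q * P * Q + P * (Q * Q) * P := by noncomm_ring
      _ = t • S := by
          rw [hPP, hQQ, hPQP, hQPQ, smul_mul_assoc, smul_mul_assoc, hS]
          module
  have hPS : P * S = (1 - t) • P := by
    calc P * S = P * P + P * Q - P * P * Q - P * Q * P := by rw [hS]; noncomm_ring
      _ = (1 - t) • P := by rw [hPP, hPQP]; module
  have hQS : Q * S = (1 - t) • Q := by
    calc Q * S = Q * P + Q * Q - Q * P * Q - Q * Q * P := by rw [hS]; noncomm_ring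
      _ = (1 - t) • Q := by rw [hQQ, hQPQ]; module
  have hSS : S * S = (1 - t) • S := by
    calc S * S = P * S + Q * S - P * (Q * S) - Q * (P * S) := by
          nth_rewrite 1 [hS]; noncomm_ring
      _ = (1 - t) • S := by
          rw [hPS, hQS, mul_smul_comm, mul_smul_comm, hS]
          module
  refine le_schattenNorm_of_sq_eq_smul hp hμ ?_ ?_
  · rw [hM, smul_mul_smul_comm, hSS, hμt, smul_smul, smul_smul]
    congr 1; ring
  · rw [hM, hS, Matrix.trace_smul, Matrix.trace_sub, Matrix.trace_sub, Matrix.trace_add,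
      Matrix.trace_mul_comm Q P, hPt, hQt, hPQt, Complex.ofReal_mul, hμt, smul_eq_mul]
    push_cast; ring

/-- The rank-one measurement along unit vectors that resolve the identity. -/
noncomputable def QMeasurement.ofUnitVectors {d n : ℕ} (v : Fin n → EuclideanSpace ℂ (Fin d))
    (hv : ∀ a, ‖v a‖ = 1) (h : ∑ a, ketbra (v a) = 1) : QMeasurement d n where
  op a := ketbra (v a)
  posSemidef a := ketbra_posSemidef (v a)
  ne_zero a h0 := by
    have := trace_ketbra (v a)
    rw [h0, hv] at this
    simp at this
  sum_eq_one := h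

/-- The `b`-th vector of the Fourier basis of `ℂ^d`, with coordinates `ω ^ (b j) / √d` for
`ω = exp (2 π i / d)`. -/
noncomputable def fourierVector (d : ℕ) (b : Fin d) : EuclideanSpace ℂ (Fin d) :=
  WithLp.toLp 2 fun j =>
    Complex.exp (2 * Real.pi * Complex.I / d) ^ (b.val * j.val) / (Real.sqrt d : ℂ)

theorem norm_fourierVector_apply {d : ℕ} (b j : Fin d) :
    ‖fourierVector d b j‖ = (Real.sqrt d)⁻¹ := by
  have : NeZero d := ⟨by have := b.pos; omega⟩
  have h := (Complex.isPrimitiveRoot_exp d (NeZero.ne d)).norm'_eq_one (NeZero.ne d)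
  simp only [fourierVector]
  rw [norm_div, norm_pow, h, one_pow, Complex.norm_real, Real.norm_of_nonneg (Real.sqrt_nonneg _),
    one_div]

theorem norm_fourierVector {d : ℕ} (b : Fin d) : ‖fourierVector d b‖ = 1 := by
  have hd : (d : ℝ) ≠ 0 := by have := b.pos; exact_mod_cast this.ne'
  rw [EuclideanSpace.norm_eq]
  simp only [norm_fourierVector_apply, inv_pow, Real.sq_sqrt (Nat.cast_nonneg d), Finset.sum_const,
    Finset.card_univ, Fintype.card_fin, nsmul_eq_mul, mul_inv_cancel₀ hd, Real.sqrt_one]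

theorem sum_ketbra_fourierVector (d : ℕ) : ∑ b, ketbra (fourierVector d b) = 1 := by
  rcases Nat.eq_zero_or_pos d with rfl | hd
  · exact Subsingleton.elim _ _
  set ω := Complex.exp (2 * Real.pi * Complex.I / d) with hω
  have hprim : IsPrimitiveRoot ω d := Complex.isPrimitiveRoot_exp d hd.ne'
  have hω0 : ω ≠ 0 := Complex.exp_ne_zero _
  have hconj : starRingEnd ℂ ω = ω⁻¹ := by
    rw [Complex.inv_eq_conj (hprim.norm'_eq_one hd.ne')]
  have hdC : (d : ℂ) ≠ 0 := by exact_mod_cast hd.ne'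
  have hsq : (Real.sqrt d : ℂ) * (Real.sqrt d : ℂ) = d := by
    rw [← Complex.ofReal_mul, Real.mul_self_sqrt (Nat.cast_nonneg d)]; simp
  ext i j
  have hentry : ∀ b : Fin d, ketbra (fourierVector d b) i j =
      (d : ℂ)⁻¹ * (ω ^ i.val * (ω ^ j.val)⁻¹) ^ b.val := by
    intro b
    simp only [ketbra, Matrix.vecMulVec_apply, Pi.star_apply, fourierVector, ← hω,
      Complex.star_def, map_div₀, map_pow, hconj, Complex.conj_ofReal]
    rw [div_mul_div_comm, hsq, mul_pow, ← pow_mul, inv_pow, inv_pow, ← pow_mul, mul_comm b.val,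
      mul_comm b.val]
    ring
  rw [Matrix.sum_apply]
  simp only [hentry]
  rw [← Finset.mul_sum, Fin.sum_univ_eq_sum_range (fun b => (ω ^ i.val * (ω ^ j.val)⁻¹) ^ b) d]
  by_cases hij : i = j
  · subst hij
    rw [mul_inv_cancel₀ (pow_ne_zero _ hω0)]
    simp [hdC]
  · rw [Matrix.one_apply_ne hij]
    have h1 : ω ^ i.val * (ω ^ j.val)⁻¹ ≠ 1 := by
      intro h
      rw [mul_inv_eq_one₀ (pow_ne_zero _ hω0)] at h
      exact hij (Fin.ext (hprim.pow_inj i.isLt j.isLt h))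
    have h2 : (ω ^ i.val * (ω ^ j.val)⁻¹) ^ d = 1 := by
      rw [mul_pow, inv_pow, ← pow_mul, ← pow_mul, mul_comm i.val, mul_comm j.val, pow_mul, pow_mul,
        hprim.pow_eq_one]
      simp
    rw [geom_sum_eq h1, h2, sub_self, zero_div, mul_zero]

/-- The standard basis and the Fourier basis are mutually unbiased, which gives the value that
`Υ_p` takes at its maximizers. -/
theorem exists_le_commIncompat {d : ℕ} (hd : 2 ≤ d) {p : ℝ≥0∞} (hp : 1 ≤ p) :
    ∃ E F : QMeasurement d d,
      2 ^ (1 / p.toReal) * (d * Real.sqrt (d - 1)) ≤ commIncompat p E F := by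
  have he : ∀ a, ‖EuclideanSpace.basisFun (Fin d) ℂ a‖ = 1 :=
    (EuclideanSpace.basisFun (Fin d) ℂ).norm_eq_one
  refine ⟨QMeasurement.ofUnitVectors _ he (sum_ketbra_orthonormalBasis _),
    QMeasurement.ofUnitVectors _ norm_fourierVector (sum_ketbra_fourierVector d), ?_⟩
  have hd1 : (2 : ℝ) ≤ d := by exact_mod_cast hd
  have hd0 : (0 : ℝ) < d := by linarith
  have hs : Real.sqrt ((d : ℝ) - 1) ^ 2 = d - 1 := Real.sq_sqrt (by linarith)
  have hs0 : 0 < Real.sqrt ((d : ℝ) - 1) := Real.sqrt_pos.mpr (by linarith)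
  have h : ∀ a b : Fin d, 2 ^ (1 / p.toReal) * (Real.sqrt (d - 1) / d) ≤
      schattenNorm p (ketbra (EuclideanSpace.basisFun (Fin d) ℂ a) * ketbra (fourierVector d b) -
        ketbra (fourierVector d b) * ketbra (EuclideanSpace.basisFun (Fin d) ℂ a)) := by
    intro a b
    refine le_schattenNorm_commutator_ketbra hp (he a) (norm_fourierVector b) (by positivity) ?_
    rw [EuclideanSpace.basisFun_apply, EuclideanSpace.inner_single_left, map_one, one_mul,
      norm_fourierVector_apply, inv_pow, Real.sq_sqrt hd0.le, div_pow, hs]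
    field_simp
  calc 2 ^ (1 / p.toReal) * (d * Real.sqrt (d - 1)) =
        ∑ _a : Fin d, ∑ _b : Fin d, 2 ^ (1 / p.toReal) * (Real.sqrt ((d : ℝ) - 1) / d) := by
        simp only [Finset.sum_const, Finset.card_univ, Fintype.card_fin, nsmul_eq_mul]
        field_simp
    _ ≤ _ := Finset.sum_le_sum fun a _ => Finset.sum_le_sum fun b _ => h a b

/-! ### The robustness at a maximizer -/

theorem mainTheorem4 (d n m : ℕ) (hd : 1 ≤ d) (p : ℝ≥0∞) (hp : 1 ≤ p)
    (E : QMeasurement d n) (F : QMeasurement d m) (hmax : IsMaxCommIncompat p E F) :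
    IsGreatest (robustnessFeasible E F) (genRobustness E F) ∧
    genRobustness E F = (1 / 2 : ℝ) * (1 + 1 / Real.sqrt (d : ℝ)) ∧
    ∀ (n' m' : ℕ) (E' : QMeasurement d n') (F' : QMeasurement d m'),
      genRobustness E F ≤ genRobustness E' F' := by
  have hgreatest : IsGreatest (robustnessFeasible E F) ((1 / 2 : ℝ) * (1 + 1 / Real.sqrt d)) := by
    refine ⟨half_one_add_inv_sqrt_mem_robustnessFeasible hd E F, fun η hη => ?_⟩
    rcases hd.eq_or_lt with rfl | hd2
    · -- In dimension one all operators commute, and the value is the trivial bound `1`.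
      refine (le_one_of_mem_robustnessFeasible hd hη).trans (le_of_eq ?_)
      norm_num
    · obtain ⟨E₀, F₀, h₀⟩ := exists_le_commIncompat hd2 hp
      exact le_of_mem_robustnessFeasible_of_le_commIncompat hp hd2
        (h₀.trans (hmax _ _ E₀ F₀)) hη
  have heq : genRobustness E F = (1 / 2 : ℝ) * (1 + 1 / Real.sqrt d) := hgreatest.csSup_eq
  refine ⟨heq ▸ hgreatest, heq, fun n' m' E' F' => ?_⟩
  rw [heq]
  exact le_csSup ⟨1, fun η hη => le_one_of_mem_robustnessFeasible hd hη⟩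
    (half_one_add_inv_sqrt_mem_robustnessFeasible hd E' F')
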